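/- Let $p,n,N\ge 1$ be natural numbers, let $L_1,\dots,L_N>0$ and $\alpha_1,\dots,\alpha_N\in[0,1]$. Call a family $X_1,\dots,X_N$ of $n\times n$ (real or complex) random matrices, defined on some probability space, admissible if $X_1,\dots,X_N$ are independent and, for every $k$, $X_k$ is almost surely positive semidefinite, $\|X_k\|\le L_k$ almost surely, and $\|\mathbb{E}X_k\|=\alpha_kL_k$, where $\|\cdot\|$ is the operator norm induced by the Euclidean norm. Independent random matrices $Z_1,\dots,Z_N$ with $\mathbb{P}(Z_k=L_kI)=\alpha_k$ and $\mathbb{P}(Z_k=0)=1-\alpha_k$ for all $k$ exist, every such family is admissible, and it maximizes \[\mathbb{E}\,\mathrm{tr}\Big(\Big(\sum_{k=1}^{N}X_k\Big)^{p}\Big)\] among all admissible families, where $\mathrm{tr}$ is the (unnormalized) trace. The maximum equals $n\,\mathbb{E}\big[(f_1+\dots+f_N)^p\big]$, where $f_1,\dots,f_N$ are independent real random variables with $\mathbb{P}(f_k=L_k)=\alpha_k$ and $\mathbb{P}(f_k=0)=1-\alpha_k$. -/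

import Mathlib

open scoped Matrix.Norms.L2Operator ComplexOrder

universe u v w

/-- Matrices carry the product σ-algebra of their entries. -/
instance matrixMeasurableSpace {m n R : Type*} [MeasurableSpace R] :
    MeasurableSpace (Matrix m n R) :=
  inferInstanceAs (MeasurableSpace (m → n → R))

/-- The entrywise expectation of a random matrix. -/
noncomputable def matrixExpectation {𝕜 : Type*} [RCLike 𝕜] {n : ℕ} {Ω : Type*} [MeasurableSpace Ω]
    (μ : MeasureTheory.Measure Ω) (X : Ω → Matrix (Fin n) (Fin n) 𝕜) :
    Matrix (Fin n) (Fin n) 𝕜 :=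
  Matrix.of fun i j => ∫ ω, X ω i j ∂μ

/-- `X₁, …, X_N` are independent positive semidefinite random matrices with `‖X_k‖ ≤ L_k` and
`‖𝔼 X_k‖ = α_k L_k`; the norm is the operator norm for the Euclidean norm. -/
structure IsAdmissibleFamily {𝕜 : Type*} [RCLike 𝕜] {n N : ℕ} (L α : Fin N → ℝ)
    {Ω : Type*} [MeasurableSpace Ω] (μ : MeasureTheory.Measure Ω)
    (X : Fin N → Ω → Matrix (Fin n) (Fin n) 𝕜) : Prop where
  measurable : ∀ k, Measurable (X k)
  indep : ProbabilityTheory.iIndepFun X μ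
  posSemidef : ∀ k, ∀ᵐ ω ∂μ, (X k ω).PosSemidef
  norm_le : ∀ k, ∀ᵐ ω ∂μ, ‖X k ω‖ ≤ L k
  norm_expectation : ∀ k, ‖matrixExpectation μ (X k)‖ = α k * L k

/-- `Z₁, …, Z_N` are independent random elements with `ℙ(Z_k = a_k) = α_k` and
`ℙ(Z_k = 0) = 1 - α_k`. -/
structure IsTwoPointFamily {E : Type*} [MeasurableSpace E] [Zero E] {N : ℕ}
    (a : Fin N → E) (α : Fin N → ℝ) {Ω : Type*} [MeasurableSpace Ω]
    (μ : MeasureTheory.Measure Ω) (Z : Fin N → Ω → E) : Prop where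
  measurable : ∀ k, Measurable (Z k)
  indep : ProbabilityTheory.iIndepFun Z μ
  prob_eq : ∀ k, μ.real {ω | Z k ω = a k} = α k
  prob_zero : ∀ k, μ.real {ω | Z k ω = 0} = 1 - α k

/-- `𝔼 tr (∑ₖ X_k)^p`. For positive semidefinite `X_k` the trace is real, so taking its real part
only changes its type. -/
noncomputable def traceMoment {𝕜 : Type*} [RCLike 𝕜] {n N : ℕ} (p : ℕ) {Ω : Type*}
    [MeasurableSpace Ω] (μ : MeasureTheory.Measure Ω)
    (X : Fin N → Ω → Matrix (Fin n) (Fin n) 𝕜) : ℝ :=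
  ∫ ω, RCLike.re (((∑ k, X k ω) ^ p).trace) ∂μ

/-- The values of `𝔼 tr (∑ₖ X_k)^p` over all admissible families, on all probability spaces. -/
def admissibleTraceMoments (𝕜 : Type w) [RCLike 𝕜] (n p : ℕ) {N : ℕ} (L α : Fin N → ℝ) :
    Set ℝ :=
  {t | ∃ (Ω : Type u) (_ : MeasurableSpace Ω) (μ : MeasureTheory.Measure Ω)
    (X : Fin N → Ω → Matrix (Fin n) (Fin n) 𝕜), MeasureTheory.IsProbabilityMeasure μ ∧
      IsAdmissibleFamily L α μ X ∧ t = traceMoment p μ X}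

section TraceInequalities

open Matrix

variable {𝕜 : Type*} [RCLike 𝕜] {ι : Type*} [Fintype ι] [DecidableEq ι]

theorem Matrix.PosSemidef.exists_unitary_diagonal {C : Matrix ι ι 𝕜} (hC : C.PosSemidef) :
    ∃ (U : unitaryGroup ι 𝕜) (d : ι → ℝ), (∀ i, 0 ≤ d i) ∧ (∀ i, d i ≤ ‖C‖) ∧
      ∀ m : ℕ, C ^ m = (U : Matrix ι ι 𝕜) * diagonal (fun i => ((d i ^ m : ℝ) : 𝕜)) *
        star (U : Matrix ι ι 𝕜) := by
  have hspec := hC.1.spectral_theorem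
  have hdiag : ‖(diagonal (RCLike.ofReal ∘ hC.1.eigenvalues) : Matrix ι ι 𝕜)‖ = ‖C‖ := by
    conv_rhs => rw [hspec, Unitary.conjStarAlgAut_apply, ← Unitary.coe_star,
      CStarRing.norm_mul_coe_unitary, CStarRing.norm_coe_unitary_mul]
  refine ⟨hC.1.eigenvectorUnitary, hC.1.eigenvalues, hC.eigenvalues_nonneg, fun i => ?_,
    fun m => ?_⟩
  · rw [l2_opNorm_diagonal] at hdiag
    rw [← hdiag]
    refine le_trans ?_ (norm_le_pi_norm _ i)
    simp [le_abs_self]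
  · conv_lhs => rw [hspec, ← map_pow, diagonal_pow, Unitary.conjStarAlgAut_apply]
    congr 3
    ext i
    simp

theorem Matrix.PosSemidef.smul_one_sub {X : Matrix ι ι 𝕜} (hX : X.PosSemidef) {L : ℝ}
    (hL : ‖X‖ ≤ L) : ((L : 𝕜) • (1 : Matrix ι ι 𝕜) - X).PosSemidef := by
  obtain ⟨U, d, -, hd, hpow⟩ := hX.exists_unitary_diagonal
  have h : (L : 𝕜) • (1 : Matrix ι ι 𝕜) - X =
      (U : Matrix ι ι 𝕜) * diagonal (fun i => ((L - d i : ℝ) : 𝕜)) *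
        (U : Matrix ι ι 𝕜)ᴴ := by
    have h1 := hpow 1
    have h2 : diagonal (fun i => ((L - d i : ℝ) : 𝕜)) =
        (L : 𝕜) • (1 : Matrix ι ι 𝕜) - diagonal (fun i => ((d i : ℝ) : 𝕜)) := by
      ext i j
      by_cases hij : i = j <;> simp [hij, RCLike.real_smul_eq_coe_mul]
    simp only [pow_one] at h1
    rw [h2, mul_sub, sub_mul, ← star_eq_conjTranspose, ← h1]
    simp
  rw [h]
  refine PosSemidef.mul_mul_conjTranspose_same (.diagonal fun i => ?_) _
  simpa using (hd i).trans hL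

theorem Matrix.re_apply_le_l2_opNorm (M : Matrix ι ι 𝕜) (i : ι) : RCLike.re (M i i) ≤ ‖M‖ := by
  have h := l2_opNorm_mulVec M (EuclideanSpace.single i (1 : 𝕜))
  rw [PiLp.norm_single, norm_one, mul_one] at h
  refine (RCLike.re_le_norm _).trans (le_trans ?_ h)
  refine le_trans (le_of_eq ?_) (PiLp.norm_apply_le _ i)
  simp

theorem Matrix.PosSemidef.re_trace_mul_le {B : Matrix ι ι 𝕜} (hB : B.PosSemidef)
    (M : Matrix ι ι 𝕜) : RCLike.re (M * B).trace ≤ ‖M‖ * RCLike.re B.trace := by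
  obtain ⟨U, d, hd, -, hpow⟩ := hB.exists_unitary_diagonal
  have h1 := hpow 1
  simp only [pow_one] at h1
  have hN : ‖star (U : Matrix ι ι 𝕜) * M * (U : Matrix ι ι 𝕜)‖ = ‖M‖ := by
    rw [← Unitary.coe_star, CStarRing.norm_mul_coe_unitary, CStarRing.norm_coe_unitary_mul]
  have e1 : (M * B).trace = (star (U : Matrix ι ι 𝕜) * M * (U : Matrix ι ι 𝕜) *
      diagonal (fun i => ((d i : ℝ) : 𝕜))).trace := by
    conv_lhs => rw [h1, ← mul_assoc, trace_mul_comm]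
    simp only [mul_assoc]
  have e2 : B.trace = (diagonal (fun i => ((d i : ℝ) : 𝕜))).trace := by
    conv_lhs => rw [h1, trace_mul_comm, ← mul_assoc]
    simp
  rw [e1, e2, trace_diagonal, trace, map_sum, map_sum, Finset.mul_sum]
  refine Finset.sum_le_sum fun i _ => ?_
  rw [diag_apply, mul_diagonal, RCLike.re_mul_ofReal, RCLike.ofReal_re, ← hN]
  exact mul_le_mul_of_nonneg_right (re_apply_le_l2_opNorm _ i) (hd i)

theorem Matrix.PosSemidef.re_trace_mul_nonneg {A B : Matrix ι ι 𝕜} (hA : A.PosSemidef)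
    (hB : B.PosSemidef) : 0 ≤ RCLike.re (A * B).trace := by
  obtain ⟨U, d, hd, -, hpow⟩ := hB.exists_unitary_diagonal
  have h1 := hpow 1
  simp only [pow_one] at h1
  have hN : (star (U : Matrix ι ι 𝕜) * A * (U : Matrix ι ι 𝕜)).PosSemidef :=
    hA.conjTranspose_mul_mul_same _
  have e1 : (A * B).trace = (star (U : Matrix ι ι 𝕜) * A * (U : Matrix ι ι 𝕜) *
      diagonal (fun i => ((d i : ℝ) : 𝕜))).trace := by
    conv_lhs => rw [h1, ← mul_assoc, trace_mul_comm]
    simp only [mul_assoc]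
  rw [e1, trace, map_sum]
  refine Finset.sum_nonneg fun i _ => ?_
  rw [diag_apply, mul_diagonal, RCLike.re_mul_ofReal]
  exact mul_nonneg (RCLike.nonneg_iff.1 hN.diag_nonneg).1 (hd i)

/-- A trace form of Chebyshev's sum inequality. -/
theorem Matrix.IsHermitian.re_trace_mul_pow_mul_pow_le {X C : Matrix ι ι 𝕜} (hX : X.IsHermitian)
    (hC : C.PosSemidef) (i j : ℕ) :
    RCLike.re (X * C ^ i * X * C ^ j).trace ≤ RCLike.re (X * X * C ^ (i + j)).trace := by
  obtain ⟨U, d, hd, -, hpow⟩ := hC.exists_unitary_diagonal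
  set V : Matrix ι ι 𝕜 := (U : Matrix ι ι 𝕜)
  have hV : V * star V = 1 := Unitary.coe_mul_star_self U
  set Y : Matrix ι ι 𝕜 := star V * X * V
  have hY : Y.IsHermitian := isHermitian_conjTranspose_mul_mul V hX
  have hnorm (k l : ι) : Y k l * Y l k = ((‖Y k l‖ ^ 2 : ℝ) : 𝕜) := by
    rw [← hY.apply l k]
    simpa using RCLike.mul_conj (Y k l)
  have e1 : RCLike.re (X * C ^ i * X * C ^ j).trace =
      ∑ k, ∑ l, ‖Y k l‖ ^ 2 * (d l ^ i * d k ^ j) := by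
    have : (X * C ^ i * X * C ^ j).trace =
        (Y * diagonal (fun i_1 => ((d i_1 ^ i : ℝ) : 𝕜)) * Y *
          diagonal (fun i_1 => ((d i_1 ^ j : ℝ) : 𝕜))).trace := by
      rw [hpow i, hpow j, ← mul_assoc, trace_mul_comm]
      simp only [Y, mul_assoc]
    rw [this, trace, map_sum]
    refine Finset.sum_congr rfl fun k _ => ?_
    rw [diag_apply, mul_diagonal, mul_apply, Finset.sum_mul, map_sum]
    refine Finset.sum_congr rfl fun l _ => ?_
    rw [mul_diagonal, mul_right_comm (Y k l), hnorm, mul_assoc, ← RCLike.ofReal_mul,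
      ← RCLike.ofReal_mul, RCLike.ofReal_re]
  have e2 : RCLike.re (X * X * C ^ (i + j)).trace =
      ∑ k, ∑ l, ‖Y k l‖ ^ 2 * d k ^ (i + j) := by
    have : (X * X * C ^ (i + j)).trace =
        (Y * Y * diagonal (fun i_1 => ((d i_1 ^ (i + j) : ℝ) : 𝕜))).trace := by
      have hYY : Y * Y = star V * X * X * V := by
        calc Y * Y = star V * X * (V * star V) * X * V := by simp only [Y, mul_assoc]
          _ = _ := by rw [hV, mul_one]
      rw [hYY, hpow, ← mul_assoc, trace_mul_comm]
      simp only [mul_assoc]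
    rw [this, trace, map_sum]
    refine Finset.sum_congr rfl fun k _ => ?_
    rw [diag_apply, mul_diagonal, mul_apply, Finset.sum_mul, map_sum]
    refine Finset.sum_congr rfl fun l _ => ?_
    rw [hnorm, ← RCLike.ofReal_mul, RCLike.ofReal_re]
  have hsymm (k l : ι) : ‖Y l k‖ = ‖Y k l‖ := by
    rw [← hY.apply l k, norm_star]
  have e1' : ∑ k, ∑ l, ‖Y k l‖ ^ 2 * (d l ^ i * d k ^ j) =
      ∑ k, ∑ l, ‖Y k l‖ ^ 2 * (d k ^ i * d l ^ j) := by
    rw [Finset.sum_comm]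
    simp only [hsymm]
  have e2' : ∑ k, ∑ l, ‖Y k l‖ ^ 2 * d k ^ (i + j) =
      ∑ k, ∑ l, ‖Y k l‖ ^ 2 * d l ^ (i + j) := by
    rw [Finset.sum_comm]
    simp only [hsymm]
  have key : 0 ≤ ∑ k, ∑ l, ‖Y k l‖ ^ 2 * ((d k ^ i - d l ^ i) * (d k ^ j - d l ^ j)) := by
    refine Finset.sum_nonneg fun k _ => Finset.sum_nonneg fun l _ =>
      mul_nonneg (sq_nonneg _) ?_
    rcases le_total (d k) (d l) with h | h
    · exact mul_nonneg_of_nonpos_of_nonpos (sub_nonpos.2 (pow_le_pow_left₀ (hd k) h i))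
        (sub_nonpos.2 (pow_le_pow_left₀ (hd k) h j))
    · exact mul_nonneg (sub_nonneg.2 (pow_le_pow_left₀ (hd l) h i))
        (sub_nonneg.2 (pow_le_pow_left₀ (hd l) h j))
  have expand : ∑ k, ∑ l, ‖Y k l‖ ^ 2 * ((d k ^ i - d l ^ i) * (d k ^ j - d l ^ j)) =
      ∑ k, ∑ l, ‖Y k l‖ ^ 2 * d k ^ (i + j) + ∑ k, ∑ l, ‖Y k l‖ ^ 2 * d l ^ (i + j) -
      ∑ k, ∑ l, ‖Y k l‖ ^ 2 * (d l ^ i * d k ^ j) -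
      ∑ k, ∑ l, ‖Y k l‖ ^ 2 * (d k ^ i * d l ^ j) := by
    simp only [← Finset.sum_add_distrib, ← Finset.sum_sub_distrib]
    refine Finset.sum_congr rfl fun k _ => Finset.sum_congr rfl fun l _ => ?_
    ring
  rw [e1, e2]
  linarith

theorem Matrix.PosSemidef.sub_mul_self {X : Matrix ι ι 𝕜} (hX : X.PosSemidef)
    (hX1 : (1 - X).PosSemidef) : (X - X * X).PosSemidef := by
  have h : X - X * X = Xᴴ * (1 - X) * X + (1 - X)ᴴ * X * (1 - X) := by
    rw [hX.1.eq, hX1.1.eq]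
    noncomm_ring
  rw [h]
  exact (hX1.conjTranspose_mul_mul_same X).add (hX.conjTranspose_mul_mul_same (1 - X))

theorem Matrix.PosSemidef.re_trace_mul_pow_mul_one_sub_mul_pow_nonneg {X C : Matrix ι ι 𝕜}
    (hX : X.PosSemidef) (hX1 : (1 - X).PosSemidef) (hC : C.PosSemidef) (i j : ℕ) :
    0 ≤ RCLike.re (X * (C ^ i * (1 - X) * C ^ j)).trace := by
  have h1 := hX.1.re_trace_mul_pow_mul_pow_le hC i j
  have h2 := (hX.sub_mul_self hX1).re_trace_mul_nonneg (hC.pow (i + j))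
  have e : X * (C ^ i * (1 - X) * C ^ j) =
      (X - X * X) * C ^ (i + j) + X * X * C ^ (i + j) - X * C ^ i * X * C ^ j := by
    rw [pow_add]
    noncomm_ring
  rw [e, trace_sub, trace_add, map_sub, map_add]
  linarith

theorem Matrix.hasDerivAt_pow_apply (A B : Matrix ι ι 𝕜) (q : ℕ) (t : ℝ) (i j : ι) :
    HasDerivAt (fun s : ℝ => ((A + (s : 𝕜) • B) ^ q) i j)
      ((∑ m ∈ Finset.range q,
        (A + (t : 𝕜) • B) ^ m * B * (A + (t : 𝕜) • B) ^ (q - 1 - m)) i j) t := by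
  induction q generalizing i j with
  | zero => simpa using hasDerivAt_const t _
  | succ q ih =>
    have hlin (k : ι) : HasDerivAt (fun s : ℝ => (A + (s : 𝕜) • B) k j) (B k j) t := by
      simpa [RCLike.real_smul_eq_coe_mul] using (((RCLike.ofRealCLM (K := 𝕜)).hasDerivAt (x := t)).mul_const (B k j)).const_add (A k j)
    have h := HasDerivAt.fun_sum (u := Finset.univ) fun k _ => (ih i k).mul (hlin k)
    convert! h using 1
    rw [Finset.sum_add_distrib, ← mul_apply, ← mul_apply, ← add_apply,
      Finset.sum_range_succ, Finset.sum_mul]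
    refine congrArg (fun M : Matrix ι ι 𝕜 => M i j)
      (congrArg₂ (· + ·) (Finset.sum_congr rfl fun m hm => ?_) ?_)
    · have : q + 1 - 1 - m = q - 1 - m + 1 := by have := Finset.mem_range.1 hm; omega
      rw [this, pow_succ]
      simp only [mul_assoc]
    · simp

theorem Matrix.hasDerivAt_re_trace_mul_pow (Y A B : Matrix ι ι 𝕜) (q : ℕ) (t : ℝ) :
    HasDerivAt (fun s : ℝ => RCLike.re (Y * (A + (s : 𝕜) • B) ^ q).trace)
      (∑ m ∈ Finset.range q, RCLike.re
        (Y * ((A + (t : 𝕜) • B) ^ m * B * (A + (t : 𝕜) • B) ^ (q - 1 - m))).trace) t := by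
  have h : HasDerivAt (fun s : ℝ => ∑ i, ∑ j, Y i j * ((A + (s : 𝕜) • B) ^ q) j i)
      (∑ i, ∑ j, Y i j * (∑ m ∈ Finset.range q,
        (A + (t : 𝕜) • B) ^ m * B * (A + (t : 𝕜) • B) ^ (q - 1 - m)) j i) t :=
    HasDerivAt.fun_sum fun i _ => HasDerivAt.fun_sum fun j _ =>
      (hasDerivAt_pow_apply A B q t j i).const_mul (Y i j)
  have h' := (RCLike.reCLM (K := 𝕜)).hasFDerivAt.comp_hasDerivAt t h
  convert! h' using 1
  rw [← map_sum, ← trace_sum, ← Finset.mul_sum]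
  simp [trace, mul_apply]

theorem Matrix.PosSemidef.re_trace_mul_pow_le {X A : Matrix ι ι 𝕜} (hX : X.PosSemidef)
    (hX1 : (1 - X).PosSemidef) (hA : A.PosSemidef) (q : ℕ) {t : ℝ} (ht : 0 ≤ t) :
    RCLike.re (X * (A + (t : 𝕜) • X) ^ q).trace ≤
      RCLike.re (X * (A + (t : 𝕜) • (1 : Matrix ι ι 𝕜)) ^ q).trace := by
  have ht' : (0 : 𝕜) ≤ (t : 𝕜) := by simpa using ht
  set D : Matrix ι ι 𝕜 := (t : 𝕜) • (1 - X) with hD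
  have hmono : MonotoneOn
      (fun s : ℝ => RCLike.re (X * ((A + (t : 𝕜) • X) + (s : 𝕜) • D) ^ q).trace)
      (Set.Ici (0 : ℝ)) := by
    refine monotoneOn_of_hasDerivWithinAt_nonneg (convex_Ici 0)
      (fun s _ => (hasDerivAt_re_trace_mul_pow X _ D q s).continuousAt.continuousWithinAt)
      (fun s _ => (hasDerivAt_re_trace_mul_pow X _ D q s).hasDerivWithinAt) fun s hs => ?_
    rw [interior_Ici] at hs
    have hs' : (0 : 𝕜) ≤ (s : 𝕜) := by simpa using hs.le
    have hC : ((A + (t : 𝕜) • X) + (s : 𝕜) • D).PosSemidef :=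
      (hA.add (hX.smul ht')).add ((hX1.smul ht').smul hs')
    refine Finset.sum_nonneg fun m _ => ?_
    have h := hX.re_trace_mul_pow_mul_one_sub_mul_pow_nonneg hX1 hC m (q - 1 - m)
    generalize (A + (t : 𝕜) • X) + (s : 𝕜) • D = C at h ⊢
    rw [hD, mul_smul_comm, smul_mul_assoc, mul_smul_comm, trace_smul, smul_eq_mul,
      RCLike.re_ofReal_mul]
    exact mul_nonneg ht h
  have h := hmono (Set.mem_Ici.2 le_rfl) (Set.mem_Ici.2 zero_le_one) zero_le_one
  simp only [RCLike.ofReal_zero, zero_smul, add_zero, RCLike.ofReal_one, one_smul] at h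
  rwa [show A + (t : 𝕜) • X + D = A + (t : 𝕜) • (1 : Matrix ι ι 𝕜) by
    rw [hD, add_assoc, ← smul_add]; simp] at h

theorem Matrix.PosSemidef.re_trace_add_smul_pow_le {X A : Matrix ι ι 𝕜} (hX : X.PosSemidef)
    (hX1 : (1 - X).PosSemidef) (hA : A.PosSemidef) (p : ℕ) {t : ℝ} (ht : 0 ≤ t) :
    RCLike.re ((A + (t : 𝕜) • X) ^ p).trace ≤ RCLike.re (A ^ p).trace +
      RCLike.re (X * ((A + (t : 𝕜) • (1 : Matrix ι ι 𝕜)) ^ p - A ^ p)).trace := by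
  have hderiv (s : ℝ) : HasDerivAt (fun s : ℝ =>
      RCLike.re (X * (A + (s : 𝕜) • (1 : Matrix ι ι 𝕜)) ^ p).trace -
        RCLike.re (1 * (A + (s : 𝕜) • X) ^ p).trace)
      (p * (RCLike.re (X * (A + (s : 𝕜) • (1 : Matrix ι ι 𝕜)) ^ (p - 1)).trace -
        RCLike.re (X * (A + (s : 𝕜) • X) ^ (p - 1)).trace)) s := by
    convert! (hasDerivAt_re_trace_mul_pow X A 1 p s).sub
      (hasDerivAt_re_trace_mul_pow 1 A X p s) using 1
    have h1 (m : ℕ) (hm : m ∈ Finset.range p) :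
        RCLike.re (X * ((A + (s : 𝕜) • (1 : Matrix ι ι 𝕜)) ^ m * 1 *
          (A + (s : 𝕜) • (1 : Matrix ι ι 𝕜)) ^ (p - 1 - m))).trace =
        RCLike.re (X * (A + (s : 𝕜) • (1 : Matrix ι ι 𝕜)) ^ (p - 1)).trace := by
      rw [mul_one, ← pow_add, Nat.add_sub_cancel' (by have := Finset.mem_range.1 hm; omega)]
    have h2 (m : ℕ) (hm : m ∈ Finset.range p) :
        RCLike.re (1 * ((A + (s : 𝕜) • X) ^ m * X * (A + (s : 𝕜) • X) ^ (p - 1 - m))).trace =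
        RCLike.re (X * (A + (s : 𝕜) • X) ^ (p - 1)).trace := by
      rw [one_mul, mul_assoc, trace_mul_comm, mul_assoc, ← pow_add,
        Nat.sub_add_cancel (by have := Finset.mem_range.1 hm; omega)]
    rw [Finset.sum_congr rfl h1, Finset.sum_congr rfl h2]
    simp [mul_sub]
  have hmono := monotoneOn_of_hasDerivWithinAt_nonneg (convex_Ici 0)
    (fun s _ => (hderiv s).continuousAt.continuousWithinAt)
    (fun s _ => (hderiv s).hasDerivWithinAt) fun s hs => by
      rw [interior_Ici] at hs
      exact mul_nonneg (Nat.cast_nonneg p)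
        (sub_nonneg.2 (hX.re_trace_mul_pow_le hX1 hA (p - 1) (le_of_lt hs)))
  have h := hmono (Set.mem_Ici.2 le_rfl) (Set.mem_Ici.2 ht) ht
  simp only [RCLike.ofReal_zero, zero_smul, add_zero, one_mul] at h
  rw [mul_sub, trace_sub, map_sub]
  linarith

/-- `X ↦ tr (A + X)^p` lies below its linear interpolation between `0` and `L`. -/
theorem Matrix.PosSemidef.re_trace_add_pow_le {X A : Matrix ι ι 𝕜} (hX : X.PosSemidef)
    (hA : A.PosSemidef) (p : ℕ) {L : ℝ} (hL : 0 < L) (hXL : ‖X‖ ≤ L) :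
    RCLike.re ((A + X) ^ p).trace ≤ RCLike.re (A ^ p).trace +
      L⁻¹ * RCLike.re (X * ((A + (L : 𝕜) • (1 : Matrix ι ι 𝕜)) ^ p - A ^ p)).trace := by
  have hL' : (0 : 𝕜) ≤ ((L⁻¹ : ℝ) : 𝕜) := by simpa using hL.le
  have hLL : (L : 𝕜) * ((L⁻¹ : ℝ) : 𝕜) = 1 := by
    rw [← RCLike.ofReal_mul, mul_inv_cancel₀ hL.ne', RCLike.ofReal_one]
  have h1 : (1 - ((L⁻¹ : ℝ) : 𝕜) • X).PosSemidef := by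
    have := (hX.smul_one_sub hXL).smul hL'
    rwa [smul_sub, smul_smul, mul_comm, hLL, one_smul] at this
  have h := (hX.smul hL').re_trace_add_smul_pow_le h1 hA p hL.le
  rwa [smul_smul, hLL, one_smul, smul_mul_assoc, trace_smul, smul_eq_mul,
    RCLike.re_ofReal_mul] at h

theorem Matrix.PosSemidef.add_smul_one_pow_sub_pow {A : Matrix ι ι 𝕜} (hA : A.PosSemidef) (p : ℕ)
    {L : ℝ} (hL : 0 ≤ L) :
    ((A + (L : 𝕜) • (1 : Matrix ι ι 𝕜)) ^ p - A ^ p).PosSemidef := by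
  have hL' : (0 : 𝕜) ≤ (L : 𝕜) := by simpa using hL
  have hcomm : Commute A ((L : 𝕜) • (1 : Matrix ι ι 𝕜)) := (Commute.one_right A).smul_right _
  rw [hcomm.add_pow, Finset.sum_range_succ]
  simp only [tsub_self, pow_zero, mul_one, Nat.choose_self, Nat.cast_one, add_sub_cancel_right]
  refine posSemidef_sum _ fun m _ => ?_
  rw [smul_pow, one_pow, mul_smul_comm, mul_one, smul_mul_assoc, ← nsmul_eq_mul']
  refine PosSemidef.smul ?_ (pow_nonneg hL' _)
  rw [← Nat.cast_smul_eq_nsmul 𝕜]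
  exact (hA.pow m).smul (by exact_mod_cast Nat.zero_le _)

end TraceInequalities

open MeasureTheory ProbabilityTheory

section TwoPoint

variable {E : Type*} [MeasurableSpace E] [MeasurableSingletonClass E] [Zero E] {N : ℕ}
  {a : Fin N → E} {α : Fin N → ℝ} {Ω : Type*} [MeasurableSpace Ω] {μ : Measure Ω}
  [IsProbabilityMeasure μ] {Z : Fin N → Ω → E}

theorem IsTwoPointFamily.ae_eq_or_eq_zero (h : IsTwoPointFamily a α μ Z) (ha : ∀ k, a k ≠ 0)
    (k : Fin N) : ∀ᵐ ω ∂μ, Z k ω = a k ∨ Z k ω = 0 := by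
  have h1 : MeasurableSet {ω | Z k ω = a k} := h.measurable k (measurableSet_singleton _)
  have h0 : MeasurableSet {ω | Z k ω = 0} := h.measurable k (measurableSet_singleton _)
  have hdisj : Disjoint {ω | Z k ω = a k} {ω | Z k ω = 0} :=
    Set.disjoint_left.2 fun ω hω hω' => ha k (hω.symm.trans hω')
  have hu : μ.real ({ω | Z k ω = a k} ∪ {ω | Z k ω = 0}) = 1 := by
    rw [measureReal_union hdisj h0, h.prob_eq, h.prob_zero]
    ring
  have hu' : μ ({ω | Z k ω = a k} ∪ {ω | Z k ω = 0}) = 1 := by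
    rw [← ofReal_measureReal, hu, ENNReal.ofReal_one]
  exact (mem_ae_iff_prob_eq_one (h1.union h0)).2 hu'

theorem IsTwoPointFamily.integral_comp_apply {G : Type*} [NormedAddCommGroup G] [NormedSpace ℝ G]
    [CompleteSpace G]
    (h : IsTwoPointFamily a α μ Z) (ha : ∀ k, a k ≠ 0) (k : Fin N) (g : E → G) :
    ∫ ω, g (Z k ω) ∂μ = α k • g (a k) + (1 - α k) • g 0 := by
  have h1 : MeasurableSet {ω | Z k ω = a k} := h.measurable k (measurableSet_singleton _)
  have h0 : MeasurableSet {ω | Z k ω = 0} := h.measurable k (measurableSet_singleton _)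
  have hae : (fun ω => g (Z k ω)) =ᵐ[μ] fun ω =>
      {ω | Z k ω = a k}.indicator (fun _ => g (a k)) ω +
        {ω | Z k ω = 0}.indicator (fun _ => g 0) ω := by
    filter_upwards [h.ae_eq_or_eq_zero ha k] with ω hω
    rcases hω with hω | hω
    · simp [hω, ha k]
    · simp [hω, (ha k).symm]
  rw [integral_congr_ae hae, integral_add ((integrable_const _).indicator h1)
    ((integrable_const _).indicator h0), integral_indicator_const _ h1,
    integral_indicator_const _ h0, h.prob_eq, h.prob_zero]

theorem IsTwoPointFamily.integral_comp (h : IsTwoPointFamily a α μ Z) (ha : ∀ k, a k ≠ 0)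
    (F : (Fin N → E) → ℝ) :
    ∫ ω, F (fun k => Z k ω) ∂μ = ∑ S : Finset (Fin N),
      ((∏ k ∈ S, α k) * ∏ k ∈ Finset.univ \ S, (1 - α k)) *
        F (fun k => if k ∈ S then a k else 0) := by
  classical
  set T : Finset (Fin N) → Fin N → Set E := fun S k => if k ∈ S then {a k} else {0} with hT
  have hTm (S : Finset (Fin N)) (k : Fin N) : MeasurableSet (T S k) := by
    simp only [hT]
    split_ifs <;> exact measurableSet_singleton _
  set B : Finset (Fin N) → Set Ω := fun S => ⋂ k ∈ Finset.univ, Z k ⁻¹' T S k with hB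
  have hBm (S : Finset (Fin N)) : MeasurableSet (B S) :=
    Finset.measurableSet_biInter _ fun k _ => h.measurable k (hTm S k)
  have hprob (S : Finset (Fin N)) :
      μ.real (B S) = (∏ k ∈ S, α k) * ∏ k ∈ Finset.univ \ S, (1 - α k) := by
    have h1 := h.indep.measure_inter_preimage_eq_mul (S := Finset.univ) (fun k _ => hTm S k)
    rw [measureReal_def, hB, h1, ENNReal.toReal_prod,
      ← Finset.prod_sdiff (Finset.subset_univ S), mul_comm]
    congr 1
    · refine Finset.prod_congr rfl fun k hk => ?_
      rw [← h.prob_eq k]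
      simp only [hT, hk, if_true]
      rfl
    · refine Finset.prod_congr rfl fun k hk => ?_
      rw [← h.prob_zero k]
      simp only [hT, (Finset.mem_sdiff.1 hk).2, if_false]
      rfl
  have hae : (fun ω => F (fun k => Z k ω)) =ᵐ[μ] fun ω => ∑ S : Finset (Fin N),
      (B S).indicator (fun _ => F (fun k => if k ∈ S then a k else 0)) ω := by
    filter_upwards [ae_all_iff.2 (h.ae_eq_or_eq_zero ha)] with ω hω
    rw [Finset.sum_eq_single (Finset.univ.filter fun k => Z k ω = a k)]
    · rw [Set.indicator_of_mem]
      · congr 1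
        funext k
        by_cases hk : Z k ω = a k
        · simp [hk]
        · simp [(hω k).resolve_left hk]
      · simp only [hB, hT, Set.mem_iInter, Set.mem_preimage]
        intro k _
        by_cases hk : Z k ω = a k
        · simp [hk]
        · simp [(hω k).resolve_left hk, (ha k).symm]
    · intro S _ hS
      refine Set.indicator_of_notMem (fun hmem => hS ?_) _
      simp only [hB, hT, Set.mem_iInter, Set.mem_preimage] at hmem
      ext k
      have hk := hmem k (Finset.mem_univ k)
      by_cases hkS : k ∈ S
      · simpa [hkS] using hk
      · simp only [hkS, if_false, Set.mem_singleton_iff] at hk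
        simp [hkS, hk, (ha k).symm]
    · simp
  rw [integral_congr_ae hae,
    integral_finsetSum _ fun S _ => (integrable_const _).indicator (hBm S)]
  refine Finset.sum_congr rfl fun S _ => ?_
  rw [integral_indicator_const _ (hBm S), hprob, smul_eq_mul]

theorem exists_isTwoPointFamily (a : Fin N → E) (ha : ∀ k, a k ≠ 0)
    (hα : ∀ k, α k ∈ Set.Icc (0 : ℝ) 1) :
    ∃ (Ω : Type v) (_ : MeasurableSpace Ω) (μ : Measure Ω) (Z : Fin N → Ω → E),
      IsProbabilityMeasure μ ∧ IsTwoPointFamily a α μ Z := by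
  let ν : Fin N → Measure (ULift.{v} Bool) := fun k =>
    ENNReal.ofReal (α k) • Measure.dirac ⟨true⟩ + ENNReal.ofReal (1 - α k) • Measure.dirac ⟨false⟩
  have hν (k : Fin N) : IsProbabilityMeasure (ν k) := ⟨by
    simp only [ν, Measure.add_apply, Measure.smul_apply, measure_univ, smul_eq_mul, mul_one]
    rw [← ENNReal.ofReal_add (hα k).1 (sub_nonneg.2 (hα k).2)]
    simp⟩
  have hm (k : Fin N) : Measurable fun b : ULift.{v} Bool => if b.down then a k else 0 :=
    (measurable_from_top (f := fun c : Bool => if c then a k else 0)).comp measurable_down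
  have hprob (k : Fin N) (e : E) :
      (Measure.pi ν).real {ω : Fin N → ULift.{v} Bool | (if (ω k).down then a k else 0) = e} =
      (ν k).real {b | (if b.down then a k else 0) = e} :=
    congrArg ENNReal.toReal ((measurePreserving_eval ν k).measure_preimage
      (hm k (measurableSet_singleton e)).nullMeasurableSet)
  refine ⟨Fin N → ULift.{v} Bool, inferInstance, Measure.pi ν,
    fun k ω => if (ω k).down then a k else 0, inferInstance,
    fun k => (hm k).comp (measurable_pi_apply (X := fun _ => ULift.{v} Bool) k), ?_, fun k => ?_, fun k => ?_⟩
  · exact iIndepFun_pi (X := fun k (b : ULift.{v} Bool) => if b.down then a k else 0)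
      fun k => (hm k).aemeasurable
  · rw [hprob]
    simp [ν, measureReal_def, Measure.dirac_apply, (ha k).symm, (hα k).1, Set.indicator]
  · rw [hprob]
    simp [ν, measureReal_def, Measure.dirac_apply, ha k, (hα k).2, Set.indicator]

end TwoPoint

section Independence

theorem ProbabilityTheory.IndepFun.integral_comp_prod {E F Ω : Type*} [MeasurableSpace E]
    [MeasurableSpace F] [MeasurableSpace Ω] {μ : Measure Ω} [IsProbabilityMeasure μ]
    {X : Ω → E} {Y : Ω → F} (h : IndepFun X Y μ) (hX : Measurable X) (hY : Measurable Y)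
    {Φ : E → F → ℝ} (hΦ : Measurable (Function.uncurry Φ))
    (hint : Integrable (fun ω => Φ (X ω) (Y ω)) μ) :
    Integrable (fun ω' => ∫ ω, Φ (X ω) (Y ω') ∂μ) μ ∧
      ∫ ω, Φ (X ω) (Y ω) ∂μ = ∫ ω', ∫ ω, Φ (X ω) (Y ω') ∂μ ∂μ := by
  have hprod := (indepFun_iff_map_prod_eq_prod_map_map hX.aemeasurable hY.aemeasurable).1 h
  have := Measure.isProbabilityMeasure_map (μ := μ) hX.aemeasurable
  have := Measure.isProbabilityMeasure_map (μ := μ) hY.aemeasurable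
  have hint' : Integrable (Function.uncurry Φ) ((μ.map X).prod (μ.map Y)) := by
    rw [← hprod, integrable_map_measure hΦ.aestronglyMeasurable (hX.prodMk hY).aemeasurable]
    exact hint
  have hinner (y : F) : ∫ x, Φ x y ∂(μ.map X) = ∫ ω, Φ (X ω) y ∂μ :=
    integral_map hX.aemeasurable
      (hΦ.comp (measurable_id.prodMk measurable_const)).aestronglyMeasurable
  have hI := hint'.integral_prod_right
  simp only [Function.uncurry_apply_pair, hinner] at hI
  refine ⟨(integrable_map_measure hI.aestronglyMeasurable hY.aemeasurable).1 hI, ?_⟩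
  have e1 : ∫ ω, Φ (X ω) (Y ω) ∂μ = ∫ z, Function.uncurry Φ z ∂((μ.map X).prod (μ.map Y)) := by
    rw [← hprod, integral_map (hX.prodMk hY).aemeasurable hΦ.aestronglyMeasurable]
    rfl
  rw [e1, integral_prod_symm _ hint']
  simp only [Function.uncurry_apply_pair, hinner]
  exact integral_map hY.aemeasurable hI.aestronglyMeasurable

end Independence

section RandomMatrix

variable {𝕜 : Type*} [RCLike 𝕜] {n : ℕ}

instance matrixBorelSpace : BorelSpace (Matrix (Fin n) (Fin n) 𝕜) :=
  inferInstanceAs (BorelSpace (Fin n → Fin n → 𝕜))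

instance matrixSecondCountableTopology :
    SecondCountableTopology (Matrix (Fin n) (Fin n) 𝕜) :=
  inferInstanceAs (SecondCountableTopology (Fin n → Fin n → 𝕜))

instance matrixProperSpace : ProperSpace (Matrix (Fin n) (Fin n) 𝕜) :=
  FiniteDimensional.proper 𝕜 _

theorem integrable_comp_of_norm_le {Ω G : Type*} [MeasurableSpace Ω] [NormedAddCommGroup G]
    {μ : Measure Ω} [IsProbabilityMeasure μ] {Y : Ω → Matrix (Fin n) (Fin n) 𝕜} (hY : Measurable Y) {R : ℝ}
    (hR : ∀ᵐ ω ∂μ, ‖Y ω‖ ≤ R) {F : Matrix (Fin n) (Fin n) 𝕜 → G} (hF : Continuous F) :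
    Integrable (fun ω => F (Y ω)) μ := by
  obtain ⟨C, hC⟩ := (isCompact_closedBall (0 : Matrix (Fin n) (Fin n) 𝕜)
    R).exists_bound_of_continuousOn hF.continuousOn
  refine Integrable.of_bound
    (hF.stronglyMeasurable.comp_measurable hY).aestronglyMeasurable C ?_
  filter_upwards [hR] with ω hω using hC _ (by simpa using hω)

theorem continuous_re_trace_add_pow (A : Matrix (Fin n) (Fin n) 𝕜) (p : ℕ) :
    Continuous fun X : Matrix (Fin n) (Fin n) 𝕜 => RCLike.re ((A + X) ^ p).trace :=
  RCLike.continuous_re.comp ((continuous_const.add continuous_id).pow p).matrix_trace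

theorem integral_re_trace_mul {Ω : Type*} [MeasurableSpace Ω] {μ : Measure Ω}
    {X : Ω → Matrix (Fin n) (Fin n) 𝕜} (hX : ∀ i j, Integrable (fun ω => X ω i j) μ)
    (B : Matrix (Fin n) (Fin n) 𝕜) :
    ∫ ω, RCLike.re (X ω * B).trace ∂μ = RCLike.re (matrixExpectation μ X * B).trace := by
  have hint (i j : Fin n) : Integrable (fun ω => X ω i j * B j i) μ := (hX i j).mul_const _
  have h : Integrable (fun ω => (X ω * B).trace) μ := by
    simp only [Matrix.trace, Matrix.diag_apply, Matrix.mul_apply]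
    exact integrable_finsetSum _ fun i _ => integrable_finsetSum _ fun j _ => hint i j
  rw [integral_re h]
  congr 1
  simp only [Matrix.trace, Matrix.diag_apply, Matrix.mul_apply]
  rw [integral_finsetSum _ fun i _ => integrable_finsetSum _ fun j _ => hint i j]
  refine Finset.sum_congr rfl fun i _ => ?_
  rw [integral_finsetSum _ fun j _ => hint i j]
  exact Finset.sum_congr rfl fun j _ => integral_mul_const _ _

theorem integral_re_trace_add_pow_le {Ω : Type*} [MeasurableSpace Ω] {μ : Measure Ω}
    [IsProbabilityMeasure μ] {X : Ω → Matrix (Fin n) (Fin n) 𝕜} (hX : Measurable X)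
    (hpos : ∀ᵐ ω ∂μ, (X ω).PosSemidef) {L α : ℝ} (hL : 0 < L) (hnorm : ∀ᵐ ω ∂μ, ‖X ω‖ ≤ L)
    (hexp : ‖matrixExpectation μ X‖ = α * L) {A : Matrix (Fin n) (Fin n) 𝕜} (hA : A.PosSemidef)
    (p : ℕ) :
    ∫ ω, RCLike.re ((A + X ω) ^ p).trace ∂μ ≤
      α * RCLike.re ((A + (L : 𝕜) • (1 : Matrix (Fin n) (Fin n) 𝕜)) ^ p).trace +
        (1 - α) * RCLike.re (A ^ p).trace := by
  set B := (A + (L : 𝕜) • (1 : Matrix (Fin n) (Fin n) 𝕜)) ^ p - A ^ p with hBdef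
  have hB : B.PosSemidef := hA.add_smul_one_pow_sub_pow p hL.le
  have hentry (i j : Fin n) : Integrable (fun ω => X ω i j) μ :=
    integrable_comp_of_norm_le hX hnorm (continuous_id.matrix_elem i j)
  have hlin : Integrable (fun ω => RCLike.re (X ω * B).trace) μ :=
    integrable_comp_of_norm_le hX hnorm
      (F := fun Y : Matrix (Fin n) (Fin n) 𝕜 => RCLike.re (Y * B).trace)
      (RCLike.continuous_re.comp (continuous_id.mul continuous_const).matrix_trace)
  have h1 : ∫ ω, RCLike.re ((A + X ω) ^ p).trace ∂μ ≤
      ∫ ω, (RCLike.re (A ^ p).trace + L⁻¹ * RCLike.re (X ω * B).trace) ∂μ := by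
    refine integral_mono_ae
      (integrable_comp_of_norm_le hX hnorm (continuous_re_trace_add_pow A p))
      ((integrable_const _).add (hlin.const_mul _)) ?_
    filter_upwards [hpos, hnorm] with ω h h' using h.re_trace_add_pow_le hA p hL h'
  rw [integral_add (integrable_const _) (hlin.const_mul _), integral_const, integral_const_mul,
    integral_re_trace_mul hentry] at h1
  have h2 := hB.re_trace_mul_le (matrixExpectation μ X)
  have h3 : L⁻¹ * RCLike.re (matrixExpectation μ X * B).trace ≤ α * RCLike.re B.trace := by
    calc L⁻¹ * RCLike.re (matrixExpectation μ X * B).trace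
        ≤ L⁻¹ * (α * L * RCLike.re B.trace) := by
          rw [← hexp]
          exact mul_le_mul_of_nonneg_left h2 (inv_nonneg.2 hL.le)
      _ = α * RCLike.re B.trace := by field_simp
  rw [hBdef, Matrix.trace_sub, map_sub, ← hBdef] at h3
  simp only [probReal_univ, one_smul] at h1
  linarith

variable {N : ℕ} {L α : Fin N → ℝ}

theorem IsAdmissibleFamily.integral_re_trace_add_sum_pow_le {Ω : Type*} [MeasurableSpace Ω]
    {μ : Measure Ω} [IsProbabilityMeasure μ] {X : Fin N → Ω → Matrix (Fin n) (Fin n) 𝕜}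
    (h : IsAdmissibleFamily L α μ X) (hL : ∀ k, 0 < L k) (hα : ∀ k, α k ∈ Set.Icc (0 : ℝ) 1)
    (p : ℕ) (s : Finset (Fin N)) {A : Matrix (Fin n) (Fin n) 𝕜} (hA : A.PosSemidef) :
    ∫ ω, RCLike.re ((A + ∑ k ∈ s, X k ω) ^ p).trace ∂μ ≤
      ∑ S ∈ s.powerset, ((∏ k ∈ S, α k) * ∏ k ∈ s \ S, (1 - α k)) *
        RCLike.re ((A + ((∑ k ∈ S, L k : ℝ) : 𝕜) • (1 : Matrix (Fin n) (Fin n) 𝕜)) ^ p).trace := by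
  classical
  induction s using Finset.induction_on generalizing A with
  | empty => simp
  | insert k s hk ih =>
    have hYm (s : Finset (Fin N)) : Measurable fun ω => ∑ l ∈ s, X l ω :=
      Finset.measurable_fun_sum _ fun l _ => h.measurable l
    have hYnorm (s : Finset (Fin N)) : ∀ᵐ ω ∂μ, ‖∑ l ∈ s, X l ω‖ ≤ ∑ l ∈ s, L l := by
      filter_upwards [ae_all_iff.2 h.norm_le] with ω hω
      exact (norm_sum_le _ _).trans (Finset.sum_le_sum fun l _ => hω l)
    have hint (s : Finset (Fin N)) (A : Matrix (Fin n) (Fin n) 𝕜) :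
        Integrable (fun ω => RCLike.re ((A + ∑ l ∈ s, X l ω) ^ p).trace) μ :=
      integrable_comp_of_norm_le (hYm s) (hYnorm s) (continuous_re_trace_add_pow A p)
    have hindep : IndepFun (X k) (fun ω => ∑ l ∈ s, X l ω) μ := by
      have := (h.indep.indepFun_finsetSum_of_notMem h.measurable hk).symm
      convert! this using 1
      funext ω
      simp
    have hLk : (0 : 𝕜) ≤ (L k : 𝕜) := by simpa using (hL k).le
    have hcont : Continuous (Function.uncurry fun x y : Matrix (Fin n) (Fin n) 𝕜 =>
        RCLike.re ((A + y + x) ^ p).trace) :=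
      RCLike.continuous_re.comp
        (((continuous_const.add continuous_snd).add continuous_fst).pow p).matrix_trace
    have hint' : Integrable
        (fun ω => RCLike.re ((A + ∑ l ∈ s, X l ω + X k ω) ^ p).trace) μ := by
      have := hint (insert k s) A
      simp only [Finset.sum_insert hk] at this
      convert! this using 5
      abel
    obtain ⟨hI, heq⟩ := hindep.integral_comp_prod (h.measurable k) (hYm s)
      hcont.measurable hint'
    set AL := A + (L k : 𝕜) • (1 : Matrix (Fin n) (Fin n) 𝕜) with hAL
    calc ∫ ω, RCLike.re ((A + ∑ l ∈ insert k s, X l ω) ^ p).trace ∂μ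
        = ∫ ω, RCLike.re ((A + ∑ l ∈ s, X l ω + X k ω) ^ p).trace ∂μ := by
          simp only [Finset.sum_insert hk, add_comm (X k _), add_assoc]
      _ = ∫ ω', ∫ ω, RCLike.re ((A + ∑ l ∈ s, X l ω' + X k ω) ^ p).trace ∂μ ∂μ := heq
      _ ≤ ∫ ω', (α k * RCLike.re ((AL + ∑ l ∈ s, X l ω') ^ p).trace +
            (1 - α k) * RCLike.re ((A + ∑ l ∈ s, X l ω') ^ p).trace) ∂μ := by
          refine integral_mono_ae hI
            (((hint s AL).const_mul _).add ((hint s A).const_mul _)) ?_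
          filter_upwards [ae_all_iff.2 h.posSemidef] with ω' hω'
          have hAY : (A + ∑ l ∈ s, X l ω').PosSemidef :=
            hA.add (Matrix.posSemidef_sum _ fun l _ => hω' l)
          have := integral_re_trace_add_pow_le (h.measurable k) (h.posSemidef k) (hL k)
            (h.norm_le k) (h.norm_expectation k) hAY p
          rwa [add_right_comm] at this
      _ = α k * ∫ ω, RCLike.re ((AL + ∑ l ∈ s, X l ω) ^ p).trace ∂μ +
            (1 - α k) * ∫ ω, RCLike.re ((A + ∑ l ∈ s, X l ω) ^ p).trace ∂μ := by
          rw [integral_add ((hint s AL).const_mul _) ((hint s A).const_mul _),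
            integral_const_mul, integral_const_mul]
      _ ≤ _ := add_le_add
          (mul_le_mul_of_nonneg_left (ih (hA.add (Matrix.PosSemidef.one.smul hLk))) (hα k).1)
          (mul_le_mul_of_nonneg_left (ih hA) (sub_nonneg.2 (hα k).2))
      _ = _ := by
          rw [Finset.sum_powerset_insert hk, add_comm, Finset.mul_sum, Finset.mul_sum]
          congr 1
          · refine Finset.sum_congr rfl fun S hS => ?_
            have hkS : k ∉ S := fun h => hk (Finset.mem_powerset.1 hS h)
            rw [Finset.insert_sdiff_of_notMem _ hkS,
              Finset.prod_insert fun h => hk (Finset.mem_sdiff.1 h).1]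
            ring
          · refine Finset.sum_congr rfl fun S hS => ?_
            have hkS : k ∉ S := fun h => hk (Finset.mem_powerset.1 hS h)
            have hsd : insert k s \ insert k S = s \ S := by
              ext l
              by_cases hl : l = k <;> simp [hl, hk]
            rw [hsd, Finset.prod_insert hkS, Finset.sum_insert hkS, RCLike.ofReal_add, add_smul,
              ← add_assoc, ← hAL]
            ring

theorem re_trace_smul_one_pow (c : ℝ) (p : ℕ) :
    RCLike.re (((c : 𝕜) • (1 : Matrix (Fin n) (Fin n) 𝕜)) ^ p).trace = c ^ p * n := by
  rw [smul_pow, one_pow, Matrix.trace_smul, Matrix.trace_one, smul_eq_mul, ← RCLike.ofReal_pow,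
    RCLike.re_ofReal_mul]
  simp

theorem IsAdmissibleFamily.traceMoment_le {Ω : Type*} [MeasurableSpace Ω]
    {μ : Measure Ω} [IsProbabilityMeasure μ] {X : Fin N → Ω → Matrix (Fin n) (Fin n) 𝕜}
    (h : IsAdmissibleFamily L α μ X) (hL : ∀ k, 0 < L k) (hα : ∀ k, α k ∈ Set.Icc (0 : ℝ) 1)
    (p : ℕ) :
    traceMoment p μ X ≤ ∑ S : Finset (Fin N),
      ((∏ k ∈ S, α k) * ∏ k ∈ Finset.univ \ S, (1 - α k)) * ((∑ k ∈ S, L k) ^ p * n) := by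
  have := h.integral_re_trace_add_sum_pow_le hL hα p Finset.univ Matrix.PosSemidef.zero
  simp only [zero_add, re_trace_smul_one_pow, Finset.powerset_univ] at this
  exact this

theorem smul_one_ne_zero (hn : 1 ≤ n) {c : ℝ} (hc : 0 < c) :
    (c : 𝕜) • (1 : Matrix (Fin n) (Fin n) 𝕜) ≠ 0 := by
  have : NeZero n := ⟨by omega⟩
  exact smul_ne_zero (by exact_mod_cast hc.ne') one_ne_zero

instance matrixMeasurableSingletonClass :
    MeasurableSingletonClass (Matrix (Fin n) (Fin n) 𝕜) :=
  inferInstanceAs (MeasurableSingletonClass (Fin n → Fin n → 𝕜))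

theorem IsTwoPointFamily.traceMoment_eq {Ω : Type*} [MeasurableSpace Ω]
    {μ : Measure Ω} [IsProbabilityMeasure μ] {Z : Fin N → Ω → Matrix (Fin n) (Fin n) 𝕜}
    (h : IsTwoPointFamily (fun k => (L k : 𝕜) • (1 : Matrix (Fin n) (Fin n) 𝕜)) α μ Z)
    (hn : 1 ≤ n) (hL : ∀ k, 0 < L k) (p : ℕ) :
    traceMoment p μ Z = ∑ S : Finset (Fin N),
      ((∏ k ∈ S, α k) * ∏ k ∈ Finset.univ \ S, (1 - α k)) * ((∑ k ∈ S, L k) ^ p * n) := by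
  refine (h.integral_comp (fun k => smul_one_ne_zero hn (hL k))
    fun z => RCLike.re (((∑ k, z k) ^ p).trace)).trans ?_
  refine Finset.sum_congr rfl fun S _ => ?_
  rw [← re_trace_smul_one_pow (𝕜 := 𝕜), Finset.sum_ite_mem, Finset.univ_inter, ← Finset.sum_smul,
    RCLike.ofReal_sum]

theorem IsTwoPointFamily.integral_sum_pow {Ω : Type*} [MeasurableSpace Ω]
    {μ : Measure Ω} [IsProbabilityMeasure μ] {f : Fin N → Ω → ℝ}
    (h : IsTwoPointFamily L α μ f) (hL : ∀ k, 0 < L k) (p : ℕ) :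
    (∫ ω, (∑ k, f k ω) ^ p ∂μ) * n = ∑ S : Finset (Fin N),
      ((∏ k ∈ S, α k) * ∏ k ∈ Finset.univ \ S, (1 - α k)) * ((∑ k ∈ S, L k) ^ p * n) := by
  rw [h.integral_comp (fun k => (hL k).ne') fun z => (∑ k, z k) ^ p, Finset.sum_mul]
  refine Finset.sum_congr rfl fun S _ => ?_
  rw [Finset.sum_ite_mem, Finset.univ_inter, mul_assoc]

theorem IsTwoPointFamily.isAdmissibleFamily {Ω : Type*} [MeasurableSpace Ω]
    {μ : Measure Ω} [IsProbabilityMeasure μ] {Z : Fin N → Ω → Matrix (Fin n) (Fin n) 𝕜}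
    (h : IsTwoPointFamily (fun k => (L k : 𝕜) • (1 : Matrix (Fin n) (Fin n) 𝕜)) α μ Z)
    (hn : 1 ≤ n) (hL : ∀ k, 0 < L k) (hα : ∀ k, α k ∈ Set.Icc (0 : ℝ) 1) :
    IsAdmissibleFamily L α μ Z := by
  have : NeZero n := ⟨by omega⟩
  have ha (k : Fin N) := smul_one_ne_zero (𝕜 := 𝕜) hn (hL k)
  have hnorm {c : ℝ} (hc : 0 ≤ c) : ‖(c : 𝕜) • (1 : Matrix (Fin n) (Fin n) 𝕜)‖ = c := by
    rw [norm_smul, CStarRing.norm_one, mul_one, RCLike.norm_ofReal, abs_of_nonneg hc]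
  refine ⟨h.measurable, h.indep, fun k => ?_, fun k => ?_, fun k => ?_⟩
  · filter_upwards [h.ae_eq_or_eq_zero ha k] with ω hω
    rcases hω with hω | hω <;> rw [hω]
    · exact Matrix.PosSemidef.one.smul (by simpa using (hL k).le)
    · exact Matrix.PosSemidef.zero
  · filter_upwards [h.ae_eq_or_eq_zero ha k] with ω hω
    rcases hω with hω | hω <;> rw [hω]
    · exact (hnorm (hL k).le).le
    · simpa using (hL k).le
  · have hE : matrixExpectation μ (Z k) =
        ((α k * L k : ℝ) : 𝕜) • (1 : Matrix (Fin n) (Fin n) 𝕜) := by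
      ext i j
      refine (h.integral_comp_apply ha k fun M => M i j).trans ?_
      rw [RCLike.real_smul_eq_coe_mul]
      simp [mul_assoc]
    rw [hE, hnorm (mul_nonneg (hα k).1 (hL k).le)]

theorem isGreatest_admissibleTraceMoments (𝕜 : Type w) [RCLike 𝕜] (hn : 1 ≤ n)
    (hL : ∀ k, 0 < L k) (hα : ∀ k, α k ∈ Set.Icc (0 : ℝ) 1) (p : ℕ) :
    IsGreatest (admissibleTraceMoments.{u, w} 𝕜 n p L α) (∑ S : Finset (Fin N),
      ((∏ k ∈ S, α k) * ∏ k ∈ Finset.univ \ S, (1 - α k)) * ((∑ k ∈ S, L k) ^ p * n)) := by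
  constructor
  · obtain ⟨Ω, mΩ, μ, Z, hμ, hZ⟩ := exists_isTwoPointFamily.{u}
      (fun k => (L k : 𝕜) • (1 : Matrix (Fin n) (Fin n) 𝕜))
      (fun k => smul_one_ne_zero hn (hL k)) hα
    exact ⟨Ω, mΩ, μ, Z, hμ, hZ.isAdmissibleFamily hn hL hα, (hZ.traceMoment_eq hn hL p).symm⟩
  · rintro t ⟨Ω, mΩ, μ, X, hμ, hX, rfl⟩
    exact hX.traceMoment_le hL hα p

end RandomMatrix

theorem theorem1p1 (𝕜 : Type w) [RCLike 𝕜] (p n N : ℕ)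
    (hp : 1 ≤ p) (hn : 1 ≤ n) (hN : 1 ≤ N) (L α : Fin N → ℝ)
    (hL : ∀ k, 0 < L k) (hα : ∀ k, α k ∈ Set.Icc (0 : ℝ) 1) :
    -- the two-point families exist, both of matrices and of scalars
    (∃ (Ω : Type v) (_ : MeasurableSpace Ω) (μ : MeasureTheory.Measure Ω)
      (Z : Fin N → Ω → Matrix (Fin n) (Fin n) 𝕜), MeasureTheory.IsProbabilityMeasure μ ∧
        IsTwoPointFamily (fun k => (L k : 𝕜) • (1 : Matrix (Fin n) (Fin n) 𝕜)) α μ Z) ∧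
    (∃ (Ω : Type v) (_ : MeasurableSpace Ω) (μ : MeasureTheory.Measure Ω)
      (f : Fin N → Ω → ℝ), MeasureTheory.IsProbabilityMeasure μ ∧
        IsTwoPointFamily L α μ f) ∧
    -- every two-point family of matrices is admissible and attains the maximum
    (∀ (Ω : Type v) [MeasurableSpace Ω] (μ : MeasureTheory.Measure Ω)
      [MeasureTheory.IsProbabilityMeasure μ] (Z : Fin N → Ω → Matrix (Fin n) (Fin n) 𝕜),
      IsTwoPointFamily (fun k => (L k : 𝕜) • (1 : Matrix (Fin n) (Fin n) 𝕜)) α μ Z →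
        IsAdmissibleFamily L α μ Z ∧
        IsGreatest (admissibleTraceMoments.{u, w} 𝕜 n p L α) (traceMoment p μ Z)) ∧
    -- the maximum is `𝔼 (f₁ + ⋯ + f_N)^p` times `n`
    (∀ (Ω : Type v) [MeasurableSpace Ω] (μ : MeasureTheory.Measure Ω)
      [MeasureTheory.IsProbabilityMeasure μ] (f : Fin N → Ω → ℝ),
      IsTwoPointFamily L α μ f →
        IsGreatest (admissibleTraceMoments.{u, w} 𝕜 n p L α)
          ((∫ ω, (∑ k, f k ω) ^ p ∂μ) * n)) := by
  refine ⟨exists_isTwoPointFamily _ (fun k => smul_one_ne_zero hn (hL k)) hα,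
    exists_isTwoPointFamily _ (fun k => (hL k).ne') hα, fun Ω _ μ _ Z hZ => ?_,
    fun Ω _ μ _ f hf => ?_⟩
  · rw [hZ.traceMoment_eq hn hL p]
    exact ⟨hZ.isAdmissibleFamily hn hL hα, isGreatest_admissibleTraceMoments 𝕜 hn hL hα p⟩
  · rw [hf.integral_sum_pow hL p]
    exact isGreatest_admissibleTraceMoments 𝕜 hn hL hα p
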